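/- Let $N$ be a positive integer, let $(w_t)_{t\ge 0}$ be an i.i.d. sequence of random variables on a probability space $(\Omega,\mathcal F,P)$ with values in a measurable space $\mathbb W$ and with law $\nu$, and let $f:\mathbb R^N\times\mathbb W\to\mathbb R^N$ be measurable. Write $f_w=f(\cdot,w)$. Assume that for every $w\in\mathbb W$ the map $f_w$ is $C^1$ and injective; that there is a constant $c>0$ with $|\det Df_w(x)|>c$ for all $x\in\mathbb R^N$, $w\in\mathbb W$; and that the random initial state $x_0$ is independent of the process $(w_t)_{t\ge0}$ and its law is absolutely continuous with respect to Lebesgue measure on $\mathbb R^N$, with a bounded density. Consider the system $$x_{t+1}=f(x_t,w_t)+u_t,\qquad t\ge 0,$$ controlled over a noiseless channel with finite alphabet $\mathcal M$, of capacity $C=\log_2|\mathcal M|$, by a causal coding and control policy: $q_t=\gamma^e_t(x_0,\dots,x_t,q_0,\dots,q_{t-1})\in\mathcal M$ and $u_t=\gamma^c_t(q_0,\dots,q_t)\in\mathbb R^N$, where the maps $\gamma^e_t$ are measurable. Suppose that under this policy the state process is AMS (asymptotically mean stationary) ergodic, that is, there is a probability measure $\tilde Q$ on the sequence space $\Sigma=(\mathbb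 R^N)^{\{0,1,2,\dots\}}$ such that $$\lim_{T\to\infty}\frac1T\sum_{t=0}^{T-1}P\big((x_{t+s})_{s\ge0}\in B\big)=\tilde Q(B)\qquad\text{for every Borel set }B\subseteq\Sigma,$$ and the shift $(\theta x)_t=x_{t+1}$ on $\Sigma$ is measure-preserving and ergodic with respect to $\tilde Q$. Let $Q$ be the image of $\tilde Q$ under the projection $\Sigma\to\mathbb R^N$, $(x_t)_{t\ge 0}\mapsto x_0$. Then $(x,w)\mapsto\log_2|\det Df_w(x)|$ is integrable with respect to $Q\times\nu$, and $$\int_{\mathbb W}\int_{\mathbb R^N}\log_2|\det Df_w(x)|\,dQ(x)\,d\nu(w)\le C.$$ -/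

import Mathlib

open MeasureTheory ProbabilityTheory Filter Topology

namespace NoiselessControl

/-- The left shift `(θ x)_t = x_{t+1}` on one-sided sequences. -/
def shift {X : Type*} (x : ℕ → X) : ℕ → X := fun t => x (t + 1)

/-- The process `x` on `(Ω, P)` is asymptotically mean stationary, with the probability measure
`Qt` on the sequence space as its asymptotic mean: for every measurable set `B` of sequences the
Cesàro means of the probabilities that the `t`-fold shifted sample path lies in `B` converge
to `Qt B`. -/
structure IsAMS {Ω X : Type*} [MeasurableSpace Ω] [MeasurableSpace X]
    (P : Measure Ω) (x : ℕ → Ω → X) (Qt : Measure (ℕ → X)) : Prop where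
  isProbabilityMeasure : IsProbabilityMeasure Qt
  tendsto_cesaro : ∀ B : Set (ℕ → X), MeasurableSet B →
    Tendsto (fun T : ℕ => (1 / (T : ℝ)) *
        ∑ t ∈ Finset.range T, P.real {ω | (shift^[t]) (fun s => x s ω) ∈ B})
      atTop (𝓝 (Qt.real B))

/-- The process is AMS ergodic with asymptotic mean `Qt`: it is AMS, and its asymptotic mean is
ergodic for the shift. -/
structure IsAMSErgodic {Ω X : Type*} [MeasurableSpace Ω] [MeasurableSpace X]
    (P : Measure Ω) (x : ℕ → Ω → X) (Qt : Measure (ℕ → X)) : Prop where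
  isAMS : IsAMS P x Qt
  ergodic : Ergodic shift Qt

/-- A causal coding and control policy for states in `ℝ^N` over a noiseless channel with finite
alphabet `M`. The encoder produces the channel symbol `q_t` from `x_0, …, x_t` and
`q_0, …, q_{t-1}`, and the controller produces `u_t` from the received symbols `q_0, …, q_t`.
The encoder is measurable in the states. -/
structure CausalPolicy (N : ℕ) (M : Type*) where
  encoder : (t : ℕ) → (Fin (t + 1) → EuclideanSpace ℝ (Fin N)) → (Fin t → M) → M
  controller : (t : ℕ) → (Fin (t + 1) → M) → EuclideanSpace ℝ (Fin N)
  measurable_encoder : ∀ (t : ℕ) (q : Fin t → M) (s : M),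
    MeasurableSet {ξ : Fin (t + 1) → EuclideanSpace ℝ (Fin N) | encoder t ξ q = s}

/-- The state process `x`, the channel symbols `q` (sent and received, as the channel is
noiseless) and the controls `u` are those of the system `x_{t+1} = f (x_t, w_t) + u_t` in closed
loop with the policy `γ`. -/
structure IsClosedLoop {N : ℕ} {W Ω M : Type*}
    (f : EuclideanSpace ℝ (Fin N) × W → EuclideanSpace ℝ (Fin N)) (w : ℕ → Ω → W)
    (γ : CausalPolicy N M) (x : ℕ → Ω → EuclideanSpace ℝ (Fin N)) (q : ℕ → Ω → M)
    (u : ℕ → Ω → EuclideanSpace ℝ (Fin N)) : Prop where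
  symbol : ∀ t ω, q t ω =
    γ.encoder t (fun i : Fin (t + 1) => x i ω) (fun i : Fin t => q i ω)
  control : ∀ t ω, u t ω = γ.controller t (fun i : Fin (t + 1) => q i ω)
  state : ∀ t ω, x (t + 1) ω = f (x t ω, w t ω) + u t ω

/-- The capacity, in bits per use, of the noiseless channel with finite alphabet `M`. -/
noncomputable def noiselessCapacity (M : Type*) [Fintype M] : ℝ :=
  Real.logb 2 (Fintype.card M)

/-- `log₂ |det Df_w(x)|`, where `f_w = f (·, w)`. -/
noncomputable def logAbsDet {N : ℕ} {W : Type*}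
    (f : EuclideanSpace ℝ (Fin N) × W → EuclideanSpace ℝ (Fin N))
    (x : EuclideanSpace ℝ (Fin N)) (w : W) : ℝ :=
  Real.logb 2 |(fderiv ℝ (fun y => f (y, w)) x).det|

end NoiselessControl

/-!
The data-rate bound is a volume-counting argument. Once the noise sequence is fixed, `T` channel
symbols select one of at most `|M| ^ T` control sequences, and for a fixed control sequence the map
from `x_0` to `x_T` is injective and `C^1`, its Jacobian determinant being the product of those of
`f (·, w_t)` along the trajectory. By the change of variables formula the initial states that are
expanded by at least `2 ^ L` and end in a ball `B` have volume at most `|M| ^ T * 2 ^ (-L) * vol B`;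
since `x_0` has a bounded density and is independent of the noise, the same bound up to a constant
holds for the probability of this event (`IsClosedLoop.measure_expanding_le`).

Let `h` be a bounded minorant of `logAbsDet f`, and suppose that its mean `l` under `Q × ν` exceeds
the capacity `C`. The probability that the sum of `h (x_t, w_t)` over `t < T` is larger than
`T * (l - 2 * ε)` tends to one for each `ε > 0`:
* replacing `h` by its average `H` over the noise costs a sum of bounded orthogonal errors, because
  `w_t` is independent of `x_0, …, x_t` (`IsClosedLoop.integral_sq_sum_le`);
* the sums of `H (x_t)` are controlled by a one-sided ergodic theorem (`ae_bddAbove_birkhoffSum`),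
  which concerns a shift-invariant event and therefore passes from the asymptotic mean to the
  process (`IsAMS.measureReal_of_invariant`).

The volume bound with `L = T * (l - 2 * ε)` then decays geometrically when `ε < (l - C) / 2`, so the
probability that `x_T` lies in any given ball tends to zero. The asymptotic mean `Q` would vanish on
every ball, which is absurd. Hence `l ≤ C`. Applied to the truncations `min (logAbsDet f) n`, which
are bounded because the Jacobian determinants are bounded away from zero, this gives integrability
and the bound for `logAbsDet f` itself by Fatou's lemma.
-/

namespace NoiselessControl

/-! ### A one-sided maximal ergodic theorem -/

section Ergodic

variable {α : Type*}

/-- The maximum of the Birkhoff sums of lengths `0, …, n`, in the recursive form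
`M_{n+1} = max 0 (φ + M_n ∘ f)`. -/
def maxBirkhoffSum (f : α → α) (φ : α → ℝ) : ℕ → α → ℝ
  | 0, _ => 0
  | n + 1, x => max 0 (φ x + maxBirkhoffSum f φ n (f x))

lemma maxBirkhoffSum_nonneg (f : α → α) (φ : α → ℝ) (n : ℕ) (x : α) :
    0 ≤ maxBirkhoffSum f φ n x := by
  cases n
  · exact le_rfl
  · exact le_max_left _ _

lemma maxBirkhoffSum_le_succ (f : α → α) (φ : α → ℝ) (n : ℕ) (x : α) :
    maxBirkhoffSum f φ n x ≤ maxBirkhoffSum f φ (n + 1) x := by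
  induction n generalizing x with
  | zero => exact maxBirkhoffSum_nonneg f φ 1 x
  | succ n ih => exact max_le_max le_rfl (by gcongr; exact ih _)

lemma birkhoffSum_le_maxBirkhoffSum (f : α → α) (φ : α → ℝ) (n : ℕ) (x : α) :
    birkhoffSum f φ n x ≤ maxBirkhoffSum f φ n x := by
  induction n generalizing x with
  | zero => simp [maxBirkhoffSum]
  | succ n ih =>
    rw [birkhoffSum_succ']
    exact le_max_of_le_right (by gcongr; exact ih _)

lemma maxBirkhoffSum_le {f : α → α} {φ : α → ℝ} {b : ℝ} (hb : ∀ x, |φ x| ≤ b) (n : ℕ) (x : α) :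
    maxBirkhoffSum f φ n x ≤ n * b := by
  induction n generalizing x with
  | zero => simp [maxBirkhoffSum]
  | succ n ih =>
    have h1 := abs_le.1 (hb x)
    have h0 : 0 ≤ b := (abs_nonneg _).trans (hb x)
    have h2 := ih (f x)
    push_cast
    exact max_le (by positivity) (by linarith)

lemma measurable_maxBirkhoffSum [MeasurableSpace α] {f : α → α} {φ : α → ℝ}
    (hf : Measurable f) (hφ : Measurable φ) (n : ℕ) : Measurable (maxBirkhoffSum f φ n) := by
  induction n with
  | zero => exact measurable_const
  | succ n ih => exact measurable_const.max (hφ.add (ih.comp hf))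

lemma measurable_birkhoffSum [MeasurableSpace α] {f : α → α} {φ : α → ℝ}
    (hf : Measurable f) (hφ : Measurable φ) (n : ℕ) : Measurable (birkhoffSum f φ n) :=
  Finset.measurable_fun_sum _ fun k _ => hφ.comp (hf.iterate k)

lemma preimage_bddAbove_birkhoffSum (f : α → α) (φ : α → ℝ) :
    f ⁻¹' {x | BddAbove (Set.range fun n => birkhoffSum f φ n x)}
      = {x | BddAbove (Set.range fun n => birkhoffSum f φ n x)} := by
  ext x
  simp only [Set.mem_preimage, Set.mem_ofPred_eq, bddAbove_def, Set.forall_mem_range]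
  constructor
  · rintro ⟨B, hB⟩
    refine ⟨max 0 (φ x + B), fun n => ?_⟩
    cases n with
    | zero => simp
    | succ n =>
      rw [birkhoffSum_succ']
      exact le_max_of_le_right (by gcongr; exact hB n)
  · rintro ⟨B, hB⟩
    refine ⟨B - φ x, fun n => ?_⟩
    have := hB (n + 1)
    rw [birkhoffSum_succ'] at this
    linarith

lemma measurableSet_bddAbove_birkhoffSum [MeasurableSpace α] {f : α → α} {φ : α → ℝ}
    (hf : Measurable f) (hφ : Measurable φ) :
    MeasurableSet {x | BddAbove (Set.range fun n => birkhoffSum f φ n x)} :=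
  measurableSet_bddAbove_range fun n => measurable_birkhoffSum hf hφ n

/-- For an ergodic map, the Birkhoff sums of a bounded function of negative mean are almost
everywhere bounded above. Otherwise they are almost everywhere unbounded above, the maxima `M_n`
tend to infinity, and `M_{n+1} - M_n ∘ f = max (-M_n ∘ f) φ`, whose integral is nonnegative since
`M_n` increases, tends to `φ`. -/
theorem ae_bddAbove_birkhoffSum [MeasurableSpace α] {μ : Measure α} [IsProbabilityMeasure μ]
    {f : α → α} (hf : Ergodic f μ) {φ : α → ℝ} (hφ : Measurable φ) {b : ℝ}
    (hb : ∀ x, |φ x| ≤ b) (hneg : ∫ x, φ x ∂μ < 0) :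
    ∀ᵐ x ∂μ, BddAbove (Set.range fun n => birkhoffSum f φ n x) := by
  rcases hf.toPreErgodic.ae_mem_or_ae_notMem
    (measurableSet_bddAbove_birkhoffSum hf.measurable hφ)
    (preimage_bddAbove_birkhoffSum f φ) with h | h
  · exact h
  exfalso
  have hM := measurable_maxBirkhoffSum hf.measurable hφ
  have hint : ∀ n, Integrable (maxBirkhoffSum f φ n) μ := fun n =>
    Integrable.of_bound (hM n).aestronglyMeasurable (n * b) (Eventually.of_forall fun x => by
      rw [Real.norm_of_nonneg (maxBirkhoffSum_nonneg f φ n x)]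
      exact maxBirkhoffSum_le hb n x)
  have heq : ∀ n x, maxBirkhoffSum f φ (n + 1) x - maxBirkhoffSum f φ n (f x)
      = max (-maxBirkhoffSum f φ n (f x)) (φ x) := by
    intro n x
    simp only [maxBirkhoffSum]
    rw [← max_sub_sub_right, zero_sub, add_sub_cancel_right]
  have hlim : Tendsto (fun n => ∫ x, max (-maxBirkhoffSum f φ n (f x)) (φ x) ∂μ) atTop
      (𝓝 (∫ x, φ x ∂μ)) := by
    refine tendsto_integral_of_dominated_convergence (fun _ => b) (fun n => ?_)
      (integrable_const b) (fun n => Eventually.of_forall fun x => ?_) ?_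
    · exact ((((hM n).comp hf.measurable).neg).max hφ).aestronglyMeasurable
    · have h1 := abs_le.1 (hb x)
      have h2 := maxBirkhoffSum_nonneg f φ n (f x)
      have h0 : 0 ≤ b := (abs_nonneg _).trans (hb x)
      rw [Real.norm_eq_abs, abs_le]
      exact ⟨le_max_of_le_right h1.1, max_le (by linarith) h1.2⟩
    · filter_upwards [h] with x hx
      -- unboundedness at `x` is unboundedness at `f x`
      have hx' : ¬ BddAbove (Set.range fun n => birkhoffSum f φ n (f x)) := by
        intro hb'
        have : x ∈ f ⁻¹' {x | BddAbove (Set.range fun n => birkhoffSum f φ n x)} := hb'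
        rw [preimage_bddAbove_birkhoffSum] at this
        exact hx this
      rw [not_bddAbove_iff] at hx'
      obtain ⟨_, ⟨n, rfl⟩, hn⟩ := hx' b
      refine tendsto_const_nhds.congr' ?_
      filter_upwards [eventually_ge_atTop n] with m hm
      have hmono : Monotone fun n => maxBirkhoffSum f φ n (f x) :=
        monotone_nat_of_le_succ fun n => maxBirkhoffSum_le_succ f φ n (f x)
      have h1 := hmono hm
      have h2 := birkhoffSum_le_maxBirkhoffSum f φ n (f x)
      have h3 := abs_le.1 (hb x)
      dsimp only at hn h1
      rw [max_eq_right (by linarith)]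
  refine absurd (ge_of_tendsto' hlim fun n => ?_) (not_le.2 hneg)
  have hcomp : ∫ x, maxBirkhoffSum f φ n (f x) ∂μ = ∫ x, maxBirkhoffSum f φ n x ∂μ := by
    have := integral_map (μ := μ) hf.measurable.aemeasurable
      (f := maxBirkhoffSum f φ n) (hM n).aestronglyMeasurable
    rw [hf.toMeasurePreserving.map_eq] at this
    exact this.symm
  simp_rw [← heq]
  have hintf : Integrable (fun x => maxBirkhoffSum f φ n (f x)) μ :=
    hf.toMeasurePreserving.integrable_comp_of_integrable (hint n)
  rw [integral_sub (hint _) hintf, hcomp, sub_nonneg]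
  exact integral_mono (hint _) (hint _) fun x => maxBirkhoffSum_le_succ f φ n x

end Ergodic

/-! ### Asymptotic mean stationarity -/

section AMS

lemma shift_iterate_apply {X : Type*} (y : ℕ → X) (t s : ℕ) : (shift^[t] y) s = y (s + t) := by
  induction t generalizing y s with
  | zero => rfl
  | succ t ih =>
    rw [Function.iterate_succ_apply, ih]
    simp only [shift]
    congr 1

lemma birkhoffSum_shift {X : Type*} (φ : X → ℝ) (n : ℕ) (y : ℕ → X) :
    birkhoffSum shift (fun s : ℕ → X => φ (s 0)) n y = ∑ t ∈ Finset.range n, φ (y t) := by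
  simp [birkhoffSum, shift_iterate_apply]

variable {Ω X : Type*} [MeasurableSpace Ω] [MeasurableSpace X] {P : Measure Ω}
  {x : ℕ → Ω → X} {Qt : Measure (ℕ → X)}

/-- A shift-invariant event has the same probability under the process and under its asymptotic
mean. -/
lemma IsAMS.measureReal_of_invariant (h : IsAMS P x Qt) {B : Set (ℕ → X)} (hB : MeasurableSet B)
    (hinv : shift ⁻¹' B = B) : P.real {ω | (fun s => x s ω) ∈ B} = Qt.real B := by
  refine tendsto_nhds_unique ?_ (h.tendsto_cesaro B hB)
  have hit : ∀ t : ℕ, shift^[t] ⁻¹' B = B := fun t => by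
    rw [Set.preimage_iterate_eq]
    exact Function.IsFixedPt.iterate hinv t
  have : ∀ t : ℕ, {ω | shift^[t] (fun s => x s ω) ∈ B} = {ω | (fun s => x s ω) ∈ B} := by
    intro t
    ext ω
    change (fun s => x s ω) ∈ shift^[t] ⁻¹' B ↔ _
    rw [hit t]
    rfl
  simp_rw [this]
  refine tendsto_const_nhds.congr' ?_
  filter_upwards [eventually_gt_atTop 0] with T hT
  have : (T : ℝ) ≠ 0 := by positivity
  simp [this]

/-- A set that the states leave with probability tending to one is null for the asymptotic
mean. -/
lemma IsAMS.measureReal_eq_zero (h : IsAMS P x Qt) {A : Set X} (hA : MeasurableSet A)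
    (h0 : Tendsto (fun t => P.real {ω | x t ω ∈ A}) atTop (𝓝 0)) :
    (Qt.map fun s => s 0).real A = 0 := by
  rw [map_measureReal_apply (measurable_pi_apply 0) hA]
  refine tendsto_nhds_unique
    (h.tendsto_cesaro _ (measurable_pi_apply (X := fun _ : ℕ => X) 0 hA)) ?_
  have := h0.cesaro
  simp only [one_div]
  convert this using 7 with T t
  simp [shift_iterate_apply]

/-- Along an AMS ergodic process, the partial sums of a bounded function of the state are
eventually at least `T * c` in probability, for each `c` below the mean of the function. -/
theorem IsAMSErgodic.tendsto_measureReal_sum_lt [IsProbabilityMeasure P]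
    (h : IsAMSErgodic P x Qt) (hx : ∀ t, Measurable (x t)) {φ : X → ℝ} (hφ : Measurable φ)
    {b : ℝ} (hb : ∀ y, |φ y| ≤ b) {c : ℝ} (hc : c < ∫ y, φ y ∂(Qt.map fun s => s 0)) :
    Tendsto (fun T : ℕ => P.real {ω | ∑ t ∈ Finset.range T, φ (x t ω) < T * c}) atTop (𝓝 0) := by
  have := h.isAMS.isProbabilityMeasure
  -- the gap between `c` and `d` absorbs the bound on the Birkhoff sums of `d - φ`
  obtain ⟨d, hcd, hd⟩ := exists_between hc
  rw [integral_map (measurable_pi_apply 0).aemeasurable hφ.aestronglyMeasurable] at hd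
  set ψ : (ℕ → X) → ℝ := fun s => d - φ (s 0) with hψdef
  have hψ : Measurable ψ := measurable_const.sub (hφ.comp (measurable_pi_apply 0))
  have hint : Integrable (fun s : ℕ → X => φ (s 0)) Qt :=
    Integrable.of_bound (hφ.comp (measurable_pi_apply 0)).aestronglyMeasurable b
      (Eventually.of_forall fun s => hb _)
  have hneg : ∫ s, ψ s ∂Qt < 0 := by
    rw [hψdef, integral_sub (integrable_const d) hint]
    simpa using hd
  have hψb : ∀ s, |ψ s| ≤ |d| + b := fun s =>
    (abs_sub _ _).trans (by gcongr; exact hb _)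
  set E : Set (ℕ → X) := {y | BddAbove (Set.range fun n => birkhoffSum shift ψ n y)} with hE
  have hEm : MeasurableSet E := measurableSet_bddAbove_birkhoffSum h.ergodic.measurable hψ
  have hQE : Qt.real E = 1 := by
    rw [measureReal_def, (mem_ae_iff_prob_eq_one hEm).1
      (ae_bddAbove_birkhoffSum h.ergodic hψ hψb hneg), ENNReal.toReal_one]
  have hPE := h.isAMS.measureReal_of_invariant hEm (preimage_bddAbove_birkhoffSum shift ψ)
  rw [hQE] at hPE
  have hpath : Measurable fun ω => (fun s => x s ω) := measurable_pi_lambda _ hx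
  have hae : ∀ᵐ ω ∂P, (fun s => x s ω) ∈ E := by
    rw [measureReal_def, ENNReal.toReal_eq_one_iff] at hPE
    exact (mem_ae_iff_prob_eq_one (hpath hEm)).2 hPE
  have hS : ∀ T, MeasurableSet {ω | ∑ t ∈ Finset.range T, φ (x t ω) < T * c} := fun T =>
    measurableSet_lt (Finset.measurable_fun_sum _ fun t _ => hφ.comp (hx t)) measurable_const
  have hlim : Tendsto (fun T : ℕ => ∫ ω,
      ({ω | ∑ t ∈ Finset.range T, φ (x t ω) < T * c}.indicator (fun _ => (1 : ℝ)) ω) ∂P)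
      atTop (𝓝 (∫ _, (0 : ℝ) ∂P)) := by
    refine tendsto_integral_of_dominated_convergence (fun _ => 1)
      (fun T => (measurable_const.indicator (hS T)).aestronglyMeasurable) (integrable_const 1)
      (fun T => Eventually.of_forall fun ω => ?_) ?_
    · exact (norm_indicator_le_norm_self _ _).trans (by simp)
    · filter_upwards [hae] with ω hω
      obtain ⟨B, hB⟩ := hω
      refine tendsto_const_nhds.congr' ?_
      obtain ⟨n, hn⟩ := exists_nat_gt (B / (d - c))
      filter_upwards [eventually_ge_atTop n] with T hT
      rw [Set.indicator_of_notMem]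
      simp only [Set.mem_ofPred_eq, not_lt]
      have h1 : birkhoffSum shift ψ T (fun s => x s ω) ≤ B := hB ⟨T, rfl⟩
      rw [hψdef, birkhoffSum_shift (fun y => d - φ y)] at h1
      simp only [Finset.sum_sub_distrib, Finset.sum_const, Finset.card_range, nsmul_eq_mul] at h1
      have h2 : B / (d - c) < T := hn.trans_le (by exact_mod_cast hT)
      rw [div_lt_iff₀ (by linarith)] at h2
      linarith
  simpa [integral_indicator_const _ (hS _)] using hlim

end AMS

/-! ### Measurability of the logarithmic Jacobian -/

section Jacobian

variable {N : ℕ} {W : Type*} [MeasurableSpace W]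
  {f : EuclideanSpace ℝ (Fin N) × W → EuclideanSpace ℝ (Fin N)}

/-- No topology on `W` is needed: a directional derivative is a pointwise limit of difference
quotients, which are jointly measurable. -/
lemma measurable_fderiv_apply (hf : Measurable f)
    (hd : ∀ a, Differentiable ℝ fun y => f (y, a)) (v : EuclideanSpace ℝ (Fin N)) :
    Measurable fun p : EuclideanSpace ℝ (Fin N) × W =>
      fderiv ℝ (fun y => f (y, p.2)) p.1 v := by
  refine measurable_of_tendsto_metrizable (f := fun (n : ℕ) (p : EuclideanSpace ℝ (Fin N) × W) =>
    (n : ℝ) • (f (p.1 + (n : ℝ)⁻¹ • v, p.2) - f p)) (fun n => ?_) ?_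
  · exact ((hf.comp ((measurable_fst.add_const _).prodMk measurable_snd)).sub hf).const_smul (n : ℝ)
  · rw [tendsto_pi_nhds]
    intro p
    refine (hd p.2 p.1).hasFDerivAt.lim v (c := fun n : ℕ => (n : ℝ)) ?_
    simpa using tendsto_natCast_atTop_atTop

lemma measurable_det_fderiv (hf : Measurable f) (hd : ∀ a, Differentiable ℝ fun y => f (y, a)) :
    Measurable fun p : EuclideanSpace ℝ (Fin N) × W =>
      (fderiv ℝ (fun y => f (y, p.2)) p.1).det := by
  have h : ∀ A : EuclideanSpace ℝ (Fin N) →L[ℝ] EuclideanSpace ℝ (Fin N),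
      A.det = Matrix.det (Matrix.of fun i j => A (EuclideanSpace.single j 1) i) := by
    intro A
    rw [ContinuousLinearMap.det,
      ← LinearMap.det_toMatrix (EuclideanSpace.basisFun (Fin N) ℝ).toBasis]
    congr 1
  simp_rw [h, Matrix.det_apply]
  refine Finset.measurable_fun_sum _ fun σ _ => Measurable.const_smul
    (Finset.measurable_fun_prod _ fun i _ => ?_) _
  have h1 := measurable_fderiv_apply hf hd (EuclideanSpace.single i 1)
  exact (EuclideanSpace.proj (𝕜 := ℝ) (σ i)).continuous.measurable.comp h1

lemma measurable_logAbsDet (hf : Measurable f) (hd : ∀ a, Differentiable ℝ fun y => f (y, a)) :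
    Measurable fun p : EuclideanSpace ℝ (Fin N) × W => logAbsDet f p.1 p.2 :=
  (Real.measurable_log.comp (measurable_det_fderiv hf hd).abs).div_const _

end Jacobian

/-! ### Causality -/

/-- States and symbols up to time `T` are measurable for every σ-algebra that makes the initial
state and the noise before time `T` measurable. -/
lemma IsClosedLoop.measurable_state_symbol {N : ℕ} {W Ω M : Type*} [MeasurableSpace W] [Finite M]
    {f : EuclideanSpace ℝ (Fin N) × W → EuclideanSpace ℝ (Fin N)} {w : ℕ → Ω → W}
    {γ : CausalPolicy N M} {x : ℕ → Ω → EuclideanSpace ℝ (Fin N)} {q : ℕ → Ω → M}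
    {u : ℕ → Ω → EuclideanSpace ℝ (Fin N)} (hloop : IsClosedLoop f w γ x q u)
    [MeasurableSpace Ω] (hf : Measurable f) (hx0 : Measurable (x 0)) {T : ℕ}
    (hw : ∀ t < T, Measurable (w t)) :
    ∀ t ≤ T, Measurable (x t) ∧ ∀ s, MeasurableSet {ω | q t ω = s} := by
  intro t
  induction t using Nat.strong_induction_on with
  | _ t ih =>
  intro ht
  have hsym : ∀ n ≤ t, ∀ m : Fin n → M, MeasurableSet {ω | (fun i : Fin n => q i ω) = m} := by
    intro n hn m
    have : {ω | (fun i : Fin n => q i ω) = m} = ⋂ i : Fin n, {ω | q i ω = m i} := by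
      ext ω
      simp [funext_iff]
    rw [this]
    exact MeasurableSet.iInter fun i =>
      (ih i (i.2.trans_le hn) ((i.2.trans_le hn).le.trans ht)).2 _
  have hxt : Measurable (x t) := by
    cases t with
    | zero => exact hx0
    | succ t =>
      have hu : Measurable (u t) := by
        have hfac : u t = γ.controller t ∘ fun ω => (fun i : Fin (t + 1) => q i ω) :=
          funext fun ω => hloop.control t ω
        let _ : MeasurableSpace (Fin (t + 1) → M) := ⊤
        rw [hfac]
        refine Measurable.comp (fun _ _ => trivial) (measurable_to_countable' fun m => ?_)
        exact hsym (t + 1) le_rfl m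
      have : x (t + 1) = fun ω => f (x t ω, w t ω) + u t ω := funext fun ω => hloop.state t ω
      rw [this]
      exact (hf.comp ((ih t (Nat.lt_succ_self t) (Nat.le_of_succ_le ht)).1.prodMk
        (hw t ht))).add hu
  refine ⟨hxt, fun s => ?_⟩
  have : {ω | q t ω = s} = ⋃ m : Fin t → M, {ω | (fun i : Fin t => q i ω) = m} ∩
      (fun ω => fun i : Fin (t + 1) => x i ω) ⁻¹' {ξ | γ.encoder t ξ m = s} := by
    ext ω
    simp [hloop.symbol t ω]
  rw [this]
  refine MeasurableSet.iUnion fun m => (hsym t le_rfl m).inter ?_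
  refine measurable_pi_lambda _ (fun i => ?_) (γ.measurable_encoder t m s)
  rcases (Nat.lt_succ_iff.1 i.2).lt_or_eq with h | h
  · exact (ih i h (h.le.trans ht)).1
  · rw [h]; exact hxt

/-! ### Orthogonality of the noise-averaging errors -/

section Noise

variable {Ω : Type*} [MeasurableSpace Ω] {P : Measure Ω} [IsProbabilityMeasure P]

lemma indepFun_prodMk_left {α β δ : Type*} [MeasurableSpace α] [MeasurableSpace β]
    [MeasurableSpace δ] {X : Ω → α} {Y : Ω → β} {Z : Ω → δ} (hX : Measurable X)
    (hY : Measurable Y) (hZ : Measurable Z) (h1 : IndepFun X (fun ω => (Y ω, Z ω)) P)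
    (h2 : IndepFun Y Z P) : IndepFun (fun ω => (X ω, Y ω)) Z P := by
  have hXY : IndepFun X Y P := h1.comp measurable_id measurable_fst
  rw [indepFun_iff_map_prod_eq_prod_map_map hX.aemeasurable hY.aemeasurable] at hXY
  rw [indepFun_iff_map_prod_eq_prod_map_map hY.aemeasurable hZ.aemeasurable] at h2
  rw [indepFun_iff_map_prod_eq_prod_map_map hX.aemeasurable (hY.prodMk hZ).aemeasurable, h2] at h1
  rw [indepFun_iff_map_prod_eq_prod_map_map (hX.prodMk hY).aemeasurable hZ.aemeasurable, hXY]
  have := Measure.isProbabilityMeasure_map (μ := P) hX.aemeasurable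
  have := Measure.isProbabilityMeasure_map (μ := P) hY.aemeasurable
  have := Measure.isProbabilityMeasure_map (μ := P) hZ.aemeasurable
  have h3 := congrArg (Measure.map (MeasurableEquiv.prodAssoc (α := α) (β := β) (γ := δ)).symm) h1
  rw [Measure.map_map (MeasurableEquiv.measurable _) (hX.prodMk (hY.prodMk hZ)),
    ← Measure.prodAssoc_prod, MeasurableEquiv.map_symm_map] at h3
  exact h3

/-- The pair formed by the initial state and the noise before time `t` is independent of the noise
at time `t`. -/
lemma indepFun_initial_past_noise {E W : Type*} [MeasurableSpace E] [MeasurableSpace W]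
    {w : ℕ → Ω → W} {x₀ : Ω → E} (hx : Measurable x₀) (hw : ∀ t, Measurable (w t))
    (hwi : iIndepFun w P) (hxw : IndepFun x₀ (fun ω t => w t ω) P) (t : ℕ) :
    IndepFun (fun ω => (x₀ ω, fun i : Finset.range t => w i ω)) (w t) P := by
  refine indepFun_prodMk_left hx (measurable_pi_lambda _ fun i => hw i) (hw t) ?_ ?_
  · exact hxw.comp measurable_id
      (ψ := fun a : ℕ → W => ((fun i : Finset.range t => a i), a t)) (by fun_prop)
  · have := hwi.indepFun_finset (Finset.range t) {t} (by simp) hw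
    exact this.comp measurable_id
      (ψ := fun a : ({t} : Finset ℕ) → W => a ⟨t, by simp⟩) (measurable_pi_apply _)

/-- A function `h (y, a)` that averages to zero over `a` is orthogonal to everything independent
of `a`. -/
lemma integral_mul_eq_zero_of_indep {E W : Type*} [MeasurableSpace E] [MeasurableSpace W]
    {S : Ω → ℝ} {Y : Ω → E} {Z : Ω → W} (hS : Measurable S) (hY : Measurable Y)
    (hZ : Measurable Z) (hind : IndepFun (fun ω => (S ω, Y ω)) Z P) {h : E × W → ℝ}
    (hh : Measurable h) (h0 : ∀ y, ∫ a, h (y, a) ∂(P.map Z) = 0)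
    (hint : Integrable (fun ω => S ω * h (Y ω, Z ω)) P) :
    ∫ ω, S ω * h (Y ω, Z ω) ∂P = 0 := by
  have := Measure.isProbabilityMeasure_map (μ := P) hZ.aemeasurable
  have := Measure.isProbabilityMeasure_map (μ := P) (hS.prodMk hY).aemeasurable
  rw [indepFun_iff_map_prod_eq_prod_map_map (hS.prodMk hY).aemeasurable hZ.aemeasurable] at hind
  have hm : Measurable fun p : (ℝ × E) × W => p.1.1 * h (p.1.2, p.2) := by fun_prop
  have hT : Measurable fun ω => ((S ω, Y ω), Z ω) := (hS.prodMk hY).prodMk hZ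
  have h1 := integral_map (μ := P) hT.aemeasurable hm.aestronglyMeasurable
  have h2 := (integrable_map_measure (μ := P) hm.aestronglyMeasurable hT.aemeasurable).2 hint
  rw [← h1]
  rw [hind] at h2 ⊢
  rw [integral_prod _ h2]
  simp [integral_const_mul, h0]

end Noise

/-- The second moment of the sum of the first `T` noise-averaging errors grows at most linearly,
as the errors are bounded and orthogonal. -/
lemma IsClosedLoop.integral_sq_sum_le {N : ℕ} {W Ω M : Type*} [MeasurableSpace W]
    [MeasurableSpace Ω] [Finite M] {P : Measure Ω} [IsProbabilityMeasure P] {ν : Measure W}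
    {f : EuclideanSpace ℝ (Fin N) × W → EuclideanSpace ℝ (Fin N)} {w : ℕ → Ω → W}
    {γ : CausalPolicy N M} {x : ℕ → Ω → EuclideanSpace ℝ (Fin N)} {q : ℕ → Ω → M}
    {u : ℕ → Ω → EuclideanSpace ℝ (Fin N)} (hloop : IsClosedLoop f w γ x q u)
    (hf : Measurable f) (hw : ∀ t, Measurable (w t)) (hwi : iIndepFun w P)
    (hlaw : ∀ t, P.map (w t) = ν) (hx0 : Measurable (x 0))
    (hxw : IndepFun (x 0) (fun ω t => w t ω) P)
    {h : EuclideanSpace ℝ (Fin N) × W → ℝ} (hh : Measurable h) {b : ℝ} (hb : ∀ p, |h p| ≤ b)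
    (h0 : ∀ y, ∫ a, h (y, a) ∂ν = 0) (T : ℕ) :
    ∫ ω, (∑ t ∈ Finset.range T, h (x t ω, w t ω)) ^ 2 ∂P ≤ T * b ^ 2 := by
  have hx : ∀ t, Measurable (x t) := fun t =>
    (hloop.measurable_state_symbol hf hx0 (T := t) (fun t _ => hw t) t le_rfl).1
  have hhm : ∀ t, Measurable fun ω => h (x t ω, w t ω) := fun t =>
    hh.comp ((hx t).prodMk (hw t))
  have hSm : ∀ T, Measurable fun ω => ∑ t ∈ Finset.range T, h (x t ω, w t ω) := fun T =>
    Finset.measurable_fun_sum _ fun t _ => hhm t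
  have hSb : ∀ T ω, |∑ t ∈ Finset.range T, h (x t ω, w t ω)| ≤ T * b := fun T ω => by
    refine (Finset.abs_sum_le_sum_abs _ _).trans ?_
    refine (Finset.sum_le_sum fun t _ => hb (x t ω, w t ω)).trans ?_
    simp
  have hint : ∀ T, Integrable (fun ω => (∑ t ∈ Finset.range T, h (x t ω, w t ω)) ^ 2) P :=
    fun T => Integrable.of_bound ((hSm T).pow_const 2).aestronglyMeasurable ((T * b) ^ 2)
      (Eventually.of_forall fun ω => by
        rw [norm_pow, Real.norm_eq_abs]
        gcongr
        exact hSb T ω)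
  induction T with
  | zero => simp
  | succ T ih =>
    have hcross : Integrable (fun ω =>
        (∑ t ∈ Finset.range T, h (x t ω, w t ω)) * h (x T ω, w T ω)) P :=
      Integrable.of_bound ((hSm T).mul (hhm T)).aestronglyMeasurable (T * b * b)
        (Eventually.of_forall fun ω => by
          rw [norm_mul, Real.norm_eq_abs, Real.norm_eq_abs]
          exact mul_le_mul (hSb T ω) (hb _) (abs_nonneg _) ((abs_nonneg _).trans (hSb T ω)))
    have hsq : Integrable (fun ω => h (x T ω, w T ω) ^ 2) P :=
      Integrable.of_bound ((hhm T).pow_const 2).aestronglyMeasurable (b ^ 2)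
        (Eventually.of_forall fun ω => by
          rw [norm_pow, Real.norm_eq_abs]
          gcongr
          exact hb _)
    have hzero : ∫ ω, (∑ t ∈ Finset.range T, h (x t ω, w t ω)) * h (x T ω, w T ω) ∂P = 0 := by
      refine integral_mul_eq_zero_of_indep (hSm T) (hx T) (hw T) ?_ hh
        (by rw [hlaw]; exact h0) hcross
      have hind := indepFun_initial_past_noise hx0 hw hwi hxw T
      rw [IndepFun_iff_Indep] at hind ⊢
      refine indep_of_indep_of_le_left hind ?_
      rw [← measurable_iff_comap_le]
      -- below, `Ω` carries the σ-algebra generated by the initial state and the past noise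
      let past : Ω → EuclideanSpace ℝ (Fin N) × (Finset.range T → W) :=
        fun ω => (x 0 ω, fun i => w i ω)
      have hpast := comap_measurable (m := inferInstance) past
      have hx0' : Measurable[MeasurableSpace.comap past inferInstance] (x 0) :=
        measurable_fst.comp hpast
      have hw' : ∀ t < T, Measurable[MeasurableSpace.comap past inferInstance] (w t) :=
        fun t ht => (measurable_pi_apply (⟨t, Finset.mem_range.2 ht⟩ : Finset.range T)).comp
          (measurable_snd.comp hpast)
      have hxt := @IsClosedLoop.measurable_state_symbol _ _ _ _ _ _ _ _ _ _ _ _ hloop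
        (MeasurableSpace.comap past inferInstance) hf hx0' T hw'
      refine Measurable.prodMk ?_ (hxt T le_rfl).1
      exact Finset.measurable_fun_sum _ fun t ht => hh.comp
        ((hxt t (Finset.mem_range.1 ht).le).1.prodMk (hw' t (Finset.mem_range.1 ht)))
    have hexp : ∀ ω, (∑ t ∈ Finset.range (T + 1), h (x t ω, w t ω)) ^ 2
        = (∑ t ∈ Finset.range T, h (x t ω, w t ω)) ^ 2
          + 2 * ((∑ t ∈ Finset.range T, h (x t ω, w t ω)) * h (x T ω, w T ω))
          + h (x T ω, w T ω) ^ 2 := fun ω => by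
      rw [Finset.sum_range_succ]
      ring
    simp_rw [hexp]
    have hint' : Integrable (fun ω => (∑ t ∈ Finset.range T, h (x t ω, w t ω)) ^ 2
        + 2 * ((∑ t ∈ Finset.range T, h (x t ω, w t ω)) * h (x T ω, w T ω))) P :=
      (hint T).add (hcross.const_mul 2)
    rw [integral_add hint' hsq,
      integral_add (hint T) (hcross.const_mul 2), integral_const_mul, hzero]
    have hlast : ∫ ω, h (x T ω, w T ω) ^ 2 ∂P ≤ b ^ 2 := by
      have := integral_mono hsq (integrable_const (b ^ 2)) fun ω => by
        dsimp only
        rw [← sq_abs]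
        gcongr
        exact hb _
      simpa using this
    push_cast
    linarith

/-- In probability, the sum of the first `T` noise-averaging errors is eventually larger
than `-T * ε`. -/
lemma IsClosedLoop.tendsto_measureReal_sum_le {N : ℕ} {W Ω M : Type*} [MeasurableSpace W]
    [MeasurableSpace Ω] [Finite M] {P : Measure Ω} [IsProbabilityMeasure P] {ν : Measure W}
    {f : EuclideanSpace ℝ (Fin N) × W → EuclideanSpace ℝ (Fin N)} {w : ℕ → Ω → W}
    {γ : CausalPolicy N M} {x : ℕ → Ω → EuclideanSpace ℝ (Fin N)} {q : ℕ → Ω → M}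
    {u : ℕ → Ω → EuclideanSpace ℝ (Fin N)} (hloop : IsClosedLoop f w γ x q u)
    (hf : Measurable f) (hw : ∀ t, Measurable (w t)) (hwi : iIndepFun w P)
    (hlaw : ∀ t, P.map (w t) = ν) (hx0 : Measurable (x 0))
    (hxw : IndepFun (x 0) (fun ω t => w t ω) P)
    {h : EuclideanSpace ℝ (Fin N) × W → ℝ} (hh : Measurable h) {b : ℝ} (hb : ∀ p, |h p| ≤ b)
    (h0 : ∀ y, ∫ a, h (y, a) ∂ν = 0) {ε : ℝ} (hε : 0 < ε) :
    Tendsto (fun T : ℕ => P.real {ω | ∑ t ∈ Finset.range T, h (x t ω, w t ω) ≤ -(T * ε)})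
      atTop (𝓝 0) := by
  have hlim : Tendsto (fun T : ℕ => b ^ 2 / ε ^ 2 / (T : ℝ)) atTop (𝓝 0) :=
    tendsto_const_div_atTop_nhds_zero_nat _
  refine tendsto_of_tendsto_of_tendsto_of_le_of_le' tendsto_const_nhds hlim
    (Eventually.of_forall fun _ => measureReal_nonneg) ?_
  filter_upwards [eventually_gt_atTop 0] with T hT
  have hT' : (0 : ℝ) < T := by exact_mod_cast hT
  have hx : ∀ t, Measurable (x t) := fun t =>
    (hloop.measurable_state_symbol hf hx0 (T := t) (fun t _ => hw t) t le_rfl).1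
  have hSm : Measurable fun ω => ∑ t ∈ Finset.range T, h (x t ω, w t ω) :=
    Finset.measurable_fun_sum _ fun t _ => hh.comp ((hx t).prodMk (hw t))
  have hint : Integrable (fun ω => (∑ t ∈ Finset.range T, h (x t ω, w t ω)) ^ 2) P :=
    Integrable.of_bound (hSm.pow_const 2).aestronglyMeasurable ((T * b) ^ 2)
      (Eventually.of_forall fun ω => by
        rw [norm_pow, Real.norm_eq_abs]
        gcongr
        refine (Finset.abs_sum_le_sum_abs _ _).trans ?_
        refine (Finset.sum_le_sum fun t _ => hb (x t ω, w t ω)).trans ?_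
        simp)
  have hmarkov := mul_meas_ge_le_integral_of_nonneg (μ := P)
    (Eventually.of_forall fun ω => sq_nonneg (∑ t ∈ Finset.range T, h (x t ω, w t ω))) hint
    ((T * ε) ^ 2)
  have hsecond := hloop.integral_sq_sum_le hf hw hwi hlaw hx0 hxw hh hb h0 T
  have hsub : P.real {ω | ∑ t ∈ Finset.range T, h (x t ω, w t ω) ≤ -(T * ε)}
      ≤ P.real {ω | (T * ε) ^ 2 ≤ (∑ t ∈ Finset.range T, h (x t ω, w t ω)) ^ 2} := by
    refine measureReal_mono fun ω hω => ?_
    simp only [Set.mem_ofPred_eq] at hω ⊢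
    have : 0 < T * ε := by positivity
    nlinarith
  have key : (T * ε) ^ 2 * P.real {ω | ∑ t ∈ Finset.range T, h (x t ω, w t ω) ≤ -(T * ε)}
      ≤ T * b ^ 2 :=
    ((mul_le_mul_of_nonneg_left hsub (by positivity)).trans hmarkov).trans hsecond
  rw [div_div, le_div_iff₀ (by positivity)]
  refine le_of_mul_le_mul_left ?_ hT'
  linarith

/-! ### Volume contraction along a fixed control sequence -/

section Flow

variable {N : ℕ} {W : Type*}

/-- The state at time `t` as a function of the initial state, when the noise sequence `a` and the
control sequence `v` are fixed in advance. -/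
def flow (f : EuclideanSpace ℝ (Fin N) × W → EuclideanSpace ℝ (Fin N))
    (v : ℕ → EuclideanSpace ℝ (Fin N)) (a : ℕ → W) :
    ℕ → EuclideanSpace ℝ (Fin N) → EuclideanSpace ℝ (Fin N)
  | 0, y => y
  | t + 1, y => f (flow f v a t y, a t) + v t

variable {f : EuclideanSpace ℝ (Fin N) × W → EuclideanSpace ℝ (Fin N)}
  {v : ℕ → EuclideanSpace ℝ (Fin N)}

lemma injective_flow (hinj : ∀ a, Function.Injective fun y => f (y, a)) (a : ℕ → W) (t : ℕ) :
    Function.Injective (flow f v a t) := by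
  induction t with
  | zero => exact fun _ _ h => h
  | succ t ih => exact fun y z h => ih (hinj (a t) (add_right_cancel h))

lemma differentiable_flow (hd : ∀ a, Differentiable ℝ fun y => f (y, a)) (a : ℕ → W) (t : ℕ) :
    Differentiable ℝ (flow f v a t) := by
  induction t with
  | zero => exact differentiable_id
  | succ t ih => exact ((hd (a t)).comp ih).add_const _

lemma det_fderiv_flow (hd : ∀ a, Differentiable ℝ fun y => f (y, a)) (a : ℕ → W) (t : ℕ)
    (y : EuclideanSpace ℝ (Fin N)) :
    (fderiv ℝ (flow f v a t) y).det
      = ∏ s ∈ Finset.range t, (fderiv ℝ (fun z => f (z, a s)) (flow f v a s y)).det := by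
  induction t with
  | zero =>
    have : flow f v a 0 = id := rfl
    rw [this, fderiv_id]
    simp [ContinuousLinearMap.det]
  | succ t ih =>
    have hstep : HasFDerivAt (flow f v a (t + 1))
        ((fderiv ℝ (fun z => f (z, a t)) (flow f v a t y)).comp (fderiv ℝ (flow f v a t) y)) y :=
      (((hd (a t)) _).hasFDerivAt.comp y
        (differentiable_flow hd a t y).hasFDerivAt).add_const _
    rw [hstep.fderiv, Finset.prod_range_succ, ← ih, mul_comm]
    simp only [ContinuousLinearMap.det, ContinuousLinearMap.toLinearMap_comp, LinearMap.det_comp]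

lemma abs_det_fderiv_flow (hd : ∀ a, Differentiable ℝ fun y => f (y, a))
    (hdet : ∀ y a, (fderiv ℝ (fun z => f (z, a)) y).det ≠ 0) (a : ℕ → W) (t : ℕ)
    (y : EuclideanSpace ℝ (Fin N)) :
    |(fderiv ℝ (flow f v a t) y).det|
      = 2 ^ ∑ s ∈ Finset.range t, logAbsDet f (flow f v a s y) (a s) := by
  rw [det_fderiv_flow hd, Finset.abs_prod, Real.rpow_sum_of_pos two_pos]
  refine Finset.prod_congr rfl fun s _ => ?_
  rw [logAbsDet, Real.rpow_logb two_pos (by norm_num) (abs_pos.2 (hdet _ _))]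

variable [MeasurableSpace W]

lemma measurable_flow (hf : Measurable f) (t : ℕ) :
    Measurable fun p : EuclideanSpace ℝ (Fin N) × (ℕ → W) => flow f v p.2 t p.1 := by
  induction t with
  | zero => exact measurable_fst
  | succ t ih =>
    exact (hf.comp (ih.prodMk ((measurable_pi_apply t).comp measurable_snd))).add_const _

/-- The pairs of an initial state and a noise sequence for which the flow reaches the closed ball
of radius `R` at time `T`, after an expansion by at least `2 ^ L`. -/
def expandingSet (f : EuclideanSpace ℝ (Fin N) × W → EuclideanSpace ℝ (Fin N))
    (v : ℕ → EuclideanSpace ℝ (Fin N)) (T : ℕ) (R L : ℝ) :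
    Set (EuclideanSpace ℝ (Fin N) × (ℕ → W)) :=
  {p | flow f v p.2 T p.1 ∈ Metric.closedBall 0 R ∧
    L ≤ ∑ t ∈ Finset.range T, logAbsDet f (flow f v p.2 t p.1) (p.2 t)}

lemma measurableSet_expandingSet (hf : Measurable f)
    (hd : ∀ a, Differentiable ℝ fun y => f (y, a)) (T : ℕ) (R L : ℝ) :
    MeasurableSet (expandingSet f v T R L) := by
  have hball : MeasurableSet {p : EuclideanSpace ℝ (Fin N) × (ℕ → W) |
      flow f v p.2 T p.1 ∈ Metric.closedBall 0 R} :=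
    measurable_flow hf T Metric.isClosed_closedBall.measurableSet
  have hsum : Measurable fun p : EuclideanSpace ℝ (Fin N) × (ℕ → W) =>
      ∑ t ∈ Finset.range T, logAbsDet f (flow f v p.2 t p.1) (p.2 t) :=
    Finset.measurable_fun_sum _ fun t _ => (measurable_logAbsDet hf hd).comp
      ((measurable_flow hf t).prodMk ((measurable_pi_apply t).comp measurable_snd))
  exact hball.inter (measurableSet_le measurable_const hsum)

/-- Change of variables: the initial states that the flow expands by at least `2 ^ L` into a ball
have volume at most `2 ^ (-L)` times that of the ball. -/
lemma volume_slice_expandingSet_le (hf : Measurable f)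
    (hd : ∀ a, Differentiable ℝ fun y => f (y, a))
    (hinj : ∀ a, Function.Injective fun y => f (y, a))
    (hdet : ∀ y a, (fderiv ℝ (fun z => f (z, a)) y).det ≠ 0) (a : ℕ → W) (T : ℕ) (R L : ℝ) :
    volume ((fun y => (y, a)) ⁻¹' expandingSet f v T R L)
      ≤ ENNReal.ofReal (2 ^ (-L)) *
        volume (Metric.closedBall (0 : EuclideanSpace ℝ (Fin N)) R) := by
  set s := (fun y => (y, a)) ⁻¹' expandingSet f v T R L with hs
  have hsm : MeasurableSet s :=
    measurable_prodMk_right (measurableSet_expandingSet hf hd T R L)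
  have hcv := lintegral_abs_det_fderiv_eq_addHaar_image volume hsm
    (fun y _ => (differentiable_flow (v := v) hd a T y).hasFDerivAt.hasFDerivWithinAt)
    (injective_flow hinj a T).injOn
  have himg : flow f v a T '' s ⊆ Metric.closedBall 0 R := by
    rintro _ ⟨y, hy, rfl⟩
    exact hy.1
  have hlow : ENNReal.ofReal (2 ^ L) * volume s
      ≤ ∫⁻ y in s, ENNReal.ofReal |(fderiv ℝ (flow f v a T) y).det| := by
    rw [← setLIntegral_const]
    refine setLIntegral_mono' hsm fun y hy => ENNReal.ofReal_le_ofReal ?_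
    rw [abs_det_fderiv_flow hd hdet]
    exact Real.rpow_le_rpow_of_exponent_le one_le_two hy.2
  have h1 := (hlow.trans_eq hcv).trans (measure_mono himg)
  calc volume s = ENNReal.ofReal (2 ^ (-L)) * (ENNReal.ofReal (2 ^ L) * volume s) := by
        rw [← mul_assoc, ← ENNReal.ofReal_mul (by positivity), ← Real.rpow_add two_pos]
        simp
    _ ≤ _ := by gcongr

end Flow

lemma measure_le_mul_of_rnDeriv_le {α : Type*} [MeasurableSpace α] {μ ν : Measure α}
    [μ.HaveLebesgueDecomposition ν] (hac : μ ≪ ν) {K : NNReal} (hK : ∀ᵐ y ∂ν, μ.rnDeriv ν y ≤ K)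
    (s : Set α) (hs : MeasurableSet s) : μ s ≤ K * ν s := by
  rw [← Measure.withDensity_rnDeriv_eq μ ν hac, withDensity_apply _ hs, ← setLIntegral_const]
  exact lintegral_mono_ae (ae_restrict_of_ae hK)

/-- Counting argument: `T` channel symbols distinguish at most `|M| ^ T` control sequences, and for
each of them few initial states are expanded a lot and still end in a given ball. -/
lemma IsClosedLoop.measure_expanding_le {N : ℕ} {W Ω M : Type*} [MeasurableSpace W]
    [MeasurableSpace Ω] [Fintype M] {P : Measure Ω} [IsProbabilityMeasure P]
    {f : EuclideanSpace ℝ (Fin N) × W → EuclideanSpace ℝ (Fin N)} {w : ℕ → Ω → W}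
    {γ : CausalPolicy N M} {x : ℕ → Ω → EuclideanSpace ℝ (Fin N)} {q : ℕ → Ω → M}
    {u : ℕ → Ω → EuclideanSpace ℝ (Fin N)} (hloop : IsClosedLoop f w γ x q u)
    (hf : Measurable f) (hw : ∀ t, Measurable (w t)) (hx0 : Measurable (x 0))
    (hxw : IndepFun (x 0) (fun ω t => w t ω) P)
    (hd : ∀ a, Differentiable ℝ fun y => f (y, a))
    (hinj : ∀ a, Function.Injective fun y => f (y, a))
    (hdet : ∀ y a, (fderiv ℝ (fun z => f (z, a)) y).det ≠ 0)
    {K : NNReal} (hK : ∀ s, MeasurableSet s → P.map (x 0) s ≤ K * volume s)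
    (T : ℕ) (R L : ℝ) :
    P {ω | x T ω ∈ Metric.closedBall 0 R ∧
        L ≤ ∑ t ∈ Finset.range T, logAbsDet f (x t ω) (w t ω)}
      ≤ (Fintype.card M : ENNReal) ^ T * (K * (ENNReal.ofReal (2 ^ (-L)) *
        volume (Metric.closedBall (0 : EuclideanSpace ℝ (Fin N)) R))) := by
  set c := K * (ENNReal.ofReal (2 ^ (-L)) *
    volume (Metric.closedBall (0 : EuclideanSpace ℝ (Fin N)) R)) with hc
  have hwm : Measurable fun ω => (fun t => w t ω) := measurable_pi_lambda _ hw
  -- Fubini: integrate the bound on the slices over the noise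
  have hbound : ∀ v : ℕ → EuclideanSpace ℝ (Fin N),
      P ((fun ω => (x 0 ω, fun t => w t ω)) ⁻¹' expandingSet f v T R L) ≤ c := by
    intro v
    have hsm := measurableSet_expandingSet (v := v) hf hd T R L
    have := Measure.isProbabilityMeasure_map (μ := P) hx0.aemeasurable
    have := Measure.isProbabilityMeasure_map (μ := P) hwm.aemeasurable
    rw [← Measure.map_apply (hx0.prodMk hwm) hsm,
      (indepFun_iff_map_prod_eq_prod_map_map hx0.aemeasurable hwm.aemeasurable).1 hxw,
      Measure.prod_apply_symm hsm]
    calc _ ≤ ∫⁻ _, c ∂(P.map fun ω => (fun t => w t ω)) := by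
          refine lintegral_mono fun a => ?_
          refine (hK _ (measurable_prodMk_right hsm)).trans ?_
          rw [hc]
          gcongr
          exact volume_slice_expandingSet_le hf hd hinj hdet a T R L
      _ = c := by simp
  -- the controls that a word of `T` symbols produces before time `T`
  let ctrl : (Fin T → M) → ℕ → EuclideanSpace ℝ (Fin N) := fun m t =>
    if h : t < T then γ.controller t fun i => m ⟨i, by omega⟩ else 0
  have hcover : {ω | x T ω ∈ Metric.closedBall 0 R ∧
        L ≤ ∑ t ∈ Finset.range T, logAbsDet f (x t ω) (w t ω)}
      ⊆ ⋃ m : Fin T → M,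
        (fun ω => (x 0 ω, fun t => w t ω)) ⁻¹' expandingSet f (ctrl m) T R L := by
    intro ω hω
    refine Set.mem_iUnion.2 ⟨fun i => q i ω, ?_⟩
    have hflow : ∀ t ≤ T,
        flow f (ctrl fun i => q i ω) (fun t => w t ω) t (x 0 ω) = x t ω := by
      intro t
      induction t with
      | zero => exact fun _ => rfl
      | succ t ih =>
        intro ht
        have ht' : t < T := ht
        rw [flow, ih ht'.le, hloop.state, hloop.control]
        simp [ctrl, ht']
    refine ⟨?_, ?_⟩
    · simp only [hflow T le_rfl]
      exact hω.1
    · refine hω.2.trans_eq (Finset.sum_congr rfl fun t ht => ?_)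
      simp only [hflow t (Finset.mem_range.1 ht).le]
  calc _ ≤ P (⋃ m : Fin T → M,
        (fun ω => (x 0 ω, fun t => w t ω)) ⁻¹' expandingSet f (ctrl m) T R L) :=
        measure_mono hcover
    _ ≤ ∑ m : Fin T → M,
        P ((fun ω => (x 0 ω, fun t => w t ω)) ⁻¹' expandingSet f (ctrl m) T R L) :=
        measure_iUnion_fintype_le _ _
    _ ≤ ∑ _m : Fin T → M, c := Finset.sum_le_sum fun m _ => hbound _
    _ = _ := by simp

/-! ### The mean expansion rate and the capacity -/

/-- The data-rate inequality for bounded minorants `h` of the logarithmic Jacobian. If the mean of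
`h` exceeded the capacity, then along almost all trajectories the volume would expand
exponentially faster than the number of control sequences grows, so the probability of being in any
given ball at time `T` would tend to zero. -/
theorem IsClosedLoop.integral_le_capacity_of_bounded {N : ℕ} {W Ω M : Type*} [MeasurableSpace W]
    [MeasurableSpace Ω] [Fintype M] {P : Measure Ω} [IsProbabilityMeasure P] {ν : Measure W}
    {f : EuclideanSpace ℝ (Fin N) × W → EuclideanSpace ℝ (Fin N)} {w : ℕ → Ω → W}
    {γ : CausalPolicy N M} {x : ℕ → Ω → EuclideanSpace ℝ (Fin N)} {q : ℕ → Ω → M}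
    {u : ℕ → Ω → EuclideanSpace ℝ (Fin N)} (hloop : IsClosedLoop f w γ x q u)
    {Qt : Measure (ℕ → EuclideanSpace ℝ (Fin N))} (hQt : IsAMSErgodic P x Qt)
    (hf : Measurable f) (hw : ∀ t, Measurable (w t)) (hwi : iIndepFun w P)
    (hlaw : ∀ t, P.map (w t) = ν) (hx0 : Measurable (x 0))
    (hxw : IndepFun (x 0) (fun ω t => w t ω) P)
    (hd : ∀ a, Differentiable ℝ fun y => f (y, a))
    (hinj : ∀ a, Function.Injective fun y => f (y, a))
    (hdet : ∀ y a, (fderiv ℝ (fun z => f (z, a)) y).det ≠ 0)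
    {K : NNReal} (hK : ∀ s, MeasurableSet s → P.map (x 0) s ≤ K * volume s)
    {h : EuclideanSpace ℝ (Fin N) × W → ℝ} (hh : Measurable h) {b : ℝ} (hb : ∀ p, |h p| ≤ b)
    (hle : ∀ y a, h (y, a) ≤ logAbsDet f y a) :
    ∫ y, ∫ a, h (y, a) ∂ν ∂(Qt.map fun s => s 0) ≤ noiselessCapacity M := by
  have hν : IsProbabilityMeasure ν := by
    rw [← hlaw 0]
    exact Measure.isProbabilityMeasure_map (hw 0).aemeasurable
  have := hQt.isAMS.isProbabilityMeasure
  have hQ : IsProbabilityMeasure (Qt.map fun s : ℕ → EuclideanSpace ℝ (Fin N) => s 0) :=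
    Measure.isProbabilityMeasure_map (measurable_pi_apply 0).aemeasurable
  have hx : ∀ t, Measurable (x t) := fun t =>
    (hloop.measurable_state_symbol hf hx0 (T := t) (fun t _ => hw t) t le_rfl).1
  have hM : 0 < Fintype.card M := by
    obtain ⟨ω⟩ := P.nonempty_of_neZero
    exact Fintype.card_pos_iff.2 ⟨q 0 ω⟩
  by_contra! hlt
  -- `ε` is small enough for `C - (l - 2 * ε) = -2 * ε` to be negative
  set H : EuclideanSpace ℝ (Fin N) → ℝ := fun y => ∫ a, h (y, a) ∂ν with hHdef
  have hHm : Measurable H := (hh.stronglyMeasurable.integral_prod_right' (ν := ν)).measurable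
  have hHb : ∀ y, |H y| ≤ b := fun y => by
    have := norm_integral_le_of_norm_le_const (μ := ν)
      (Eventually.of_forall fun a => (Real.norm_eq_abs _).trans_le (hb (y, a)))
    simpa using this
  set l := ∫ y, H y ∂(Qt.map fun s => s 0) with hl
  set C := noiselessCapacity M with hC
  set ε := (l - C) / 4 with hεdef
  have hε : 0 < ε := by rw [hεdef]; linarith
  have hstate := hQt.tendsto_measureReal_sum_lt hx hHm hHb (c := l - ε) (by rw [← hl]; linarith)
  have hnoise := hloop.tendsto_measureReal_sum_le hf hw hwi hlaw hx0 hxw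
    (h := fun p => h p - H p.1) (hh.sub (hHm.comp measurable_fst)) (b := b + b)
    (fun p => (abs_sub _ _).trans (add_le_add (hb _) (hHb _)))
    (fun y => by
      have hi : Integrable (fun a => h (y, a)) ν :=
        Integrable.of_bound (hh.comp measurable_prodMk_left).aestronglyMeasurable b
          (Eventually.of_forall fun a => hb _)
      simp [integral_sub hi (integrable_const _), hHdef]) hε
  have hexpand : ∀ R : ℝ, Tendsto (fun T : ℕ => P.real {ω | x T ω ∈ Metric.closedBall 0 R ∧
      T * (l - 2 * ε) ≤ ∑ t ∈ Finset.range T, logAbsDet f (x t ω) (w t ω)}) atTop (𝓝 0) := by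
    intro R
    set V := volume.real (Metric.closedBall (0 : EuclideanSpace ℝ (Fin N)) R) with hV
    have hgeom : Tendsto (fun T : ℕ => (K * V) * ((2 : ℝ) ^ (-(2 * ε))) ^ T) atTop (𝓝 0) := by
      simpa using (tendsto_pow_atTop_nhds_zero_of_lt_one (by positivity)
        (Real.rpow_lt_one_of_one_lt_of_neg one_lt_two (by linarith))).const_mul (K * V)
    refine squeeze_zero (fun _ => measureReal_nonneg) (fun T => ?_) hgeom
    have hvol : volume (Metric.closedBall (0 : EuclideanSpace ℝ (Fin N)) R) ≠ ⊤ :=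
      measure_closedBall_lt_top.ne
    have hmeas := hloop.measure_expanding_le (P := P) hf hw hx0 hxw hd hinj hdet hK T R
      (T * (l - 2 * ε))
    have hreal := ENNReal.toReal_mono (by finiteness) hmeas
    rw [measureReal_def]
    refine hreal.trans_eq ?_
    have hcard : (Fintype.card M : ℝ) = 2 ^ C := by
      rw [hC, noiselessCapacity, Real.rpow_logb two_pos (by norm_num) (by exact_mod_cast hM)]
    simp only [ENNReal.toReal_mul, ENNReal.toReal_pow, ENNReal.toReal_natCast, ENNReal.coe_toReal]
    rw [ENNReal.toReal_ofReal (by positivity), hcard, ← measureReal_def, ← hV,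
      ← Real.rpow_natCast, ← Real.rpow_natCast, ← Real.rpow_mul two_pos.le,
      ← Real.rpow_mul two_pos.le]
    have hexp : -(2 * ε) * T = C * T + -(T * (l - 2 * ε)) := by rw [hεdef]; ring
    rw [hexp, Real.rpow_add two_pos]
    ring
  have hball : ∀ R : ℝ, (Qt.map fun s => s 0).real (Metric.closedBall 0 R) = 0 := by
    intro R
    refine hQt.isAMS.measureReal_eq_zero Metric.isClosed_closedBall.measurableSet ?_
    have hsum := ((hexpand R).add hstate).add hnoise
    simp only [add_zero] at hsum
    refine squeeze_zero (fun _ => measureReal_nonneg) (fun T => ?_) hsum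
    refine le_trans (measureReal_mono ?_) ((measureReal_union_le _ _).trans
      (add_le_add_left (measureReal_union_le _ _) _))
    -- in the ball, one of three rare events occurs: large expansion, a small sum of `H`, or a
    -- large noise-averaging error
    intro ω hω
    by_contra hnot
    simp only [Set.mem_union, Set.mem_ofPred_eq, not_or, not_and, not_le, not_lt] at hnot hω
    obtain ⟨⟨h1, h2⟩, h3⟩ := hnot
    have h1 := h1 hω
    have h4 : ∑ t ∈ Finset.range T, h (x t ω, w t ω)
        ≤ ∑ t ∈ Finset.range T, logAbsDet f (x t ω) (w t ω) :=
      Finset.sum_le_sum fun t _ => hle _ _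
    rw [Finset.sum_sub_distrib] at h3
    linarith
  have huniv : (Qt.map fun s => s 0) (⋃ n : ℕ,
      Metric.closedBall (0 : EuclideanSpace ℝ (Fin N)) n) = 0 := by
    refine measure_iUnion_null fun n => ?_
    exact (measureReal_eq_zero_iff).1 (hball n)
  rw [Metric.iUnion_closedBall_nat, measure_univ] at huniv
  exact one_ne_zero huniv

/-- A measurable function that is bounded below and whose truncations from above have means at most
`C` is integrable, with mean at most `C`. -/
lemma integrable_and_integral_le_of_truncations {α : Type*} [MeasurableSpace α] {μ : Measure α}
    [IsProbabilityMeasure μ] {g : α → ℝ} (hg : Measurable g) {m C : ℝ} (hm : ∀ p, m ≤ g p)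
    (hC : ∀ n : ℕ, ∫ p, min (g p) n ∂μ ≤ C) : Integrable g μ ∧ ∫ p, g p ∂μ ≤ C := by
  -- the truncation at level `n` stays above `k`, even when `n < m`
  set k := min m 0
  have hk : ∀ (n : ℕ) p, k ≤ min (g p) n := fun n p =>
    le_min ((min_le_left _ _).trans (hm p)) ((min_le_right _ _).trans (Nat.cast_nonneg n))
  have hint : ∀ n : ℕ, Integrable (fun p => min (g p) n) μ := fun n =>
    Integrable.of_bound (hg.min measurable_const).aestronglyMeasurable (max |k| n)
      (Eventually.of_forall fun p => by
        rw [Real.norm_eq_abs]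
        exact (abs_le_max_abs_abs (hk n p) (min_le_right _ _)).trans_eq (by simp))
  have hlim : ∀ p, Tendsto (fun n : ℕ => ENNReal.ofReal (min (g p) n - k)) atTop
      (𝓝 (ENNReal.ofReal (g p - k))) := by
    intro p
    refine tendsto_const_nhds.congr' ?_
    obtain ⟨n, hn⟩ := exists_nat_ge (g p)
    filter_upwards [eventually_ge_atTop n] with j hj
    rw [min_eq_left (hn.trans (by exact_mod_cast hj))]
  have hbound : ∫⁻ p, ENNReal.ofReal (g p - k) ∂μ ≤ ENNReal.ofReal (C - k) := by
    refine le_of_eq_of_le (lintegral_congr fun p => (hlim p).liminf_eq.symm) ?_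
    refine (lintegral_liminf_le fun n =>
      ((hg.min measurable_const).sub_const k).ennreal_ofReal).trans ?_
    refine liminf_le_of_le (by isBoundedDefault) fun B hB => ?_
    obtain ⟨n, hn⟩ := hB.exists
    refine hn.trans ?_
    have hintk : Integrable (fun p => min (g p) n - k) μ := (hint n).sub (integrable_const k)
    rw [← ofReal_integral_eq_lintegral_ofReal hintk
      (Eventually.of_forall fun p => sub_nonneg.2 (hk n p)),
      integral_sub (hint n) (integrable_const k)]
    refine ENNReal.ofReal_le_ofReal ?_
    simpa using hC n
  have hkg : ∀ p, 0 ≤ g p - k := fun p => sub_nonneg.2 ((min_le_left _ _).trans (hm p))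
  have hgk : Integrable (fun p => g p - k) μ := by
    refine ⟨(hg.sub_const k).aestronglyMeasurable, ?_⟩
    rw [hasFiniteIntegral_iff_ofReal (Eventually.of_forall hkg)]
    exact hbound.trans_lt ENNReal.ofReal_lt_top
  have hgi : Integrable g μ := by
    simpa [Pi.add_def] using hgk.add (integrable_const (μ := μ) k)
  refine ⟨hgi, ?_⟩
  -- so `ENNReal.ofReal (C - k)` in `hbound` is not a truncated value
  have hCk : 0 ≤ C - k := by
    have h1 : k ≤ ∫ p, min (g p) (0 : ℕ) ∂μ := by
      simpa using integral_mono (integrable_const k) (hint 0) (hk 0)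
    linarith [hC 0]
  rw [← ofReal_integral_eq_lintegral_ofReal hgk (Eventually.of_forall hkg),
    ENNReal.ofReal_le_ofReal_iff hCk, integral_sub hgi (integrable_const k)] at hbound
  simpa using hbound

end NoiselessControl

theorem theorem4p1 {N : ℕ} {W Ω M : Type*} [MeasurableSpace W] [MeasurableSpace Ω] [Fintype M]
    (P : Measure Ω) [IsProbabilityMeasure P] (ν : Measure W)
    (f : EuclideanSpace ℝ (Fin N) × W → EuclideanSpace ℝ (Fin N))
    (w : ℕ → Ω → W)
    (x : ℕ → Ω → EuclideanSpace ℝ (Fin N))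
    (q : ℕ → Ω → M)
    (u : ℕ → Ω → EuclideanSpace ℝ (Fin N))
    (γ : NoiselessControl.CausalPolicy N M)
    (Qt : Measure (ℕ → EuclideanSpace ℝ (Fin N)))
    -- the dynamics is jointly measurable
    (hf_meas : Measurable f)
    -- the noise is i.i.d. with law `ν`
    (hw_meas : ∀ t, Measurable (w t))
    (hw_indep : iIndepFun w P)
    (hw_law : ∀ t, P.map (w t) = ν)
    -- each `f_w` is `C^1` and injective
    (hf_C1 : ∀ a : W, ContDiff ℝ 1 (fun y => f (y, a)))
    (hf_inj : ∀ a : W, Function.Injective (fun y => f (y, a)))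
    -- the initial state is independent of the noise process
    (hx0_meas : Measurable (x 0))
    (hx0_indep : IndepFun (x 0) (fun ω t => w t ω) P)
    -- the law of the initial state has a bounded Lebesgue density
    (hx0_ac : P.map (x 0) ≪ volume)
    (hx0_bdd : ∃ K : NNReal, ∀ᵐ y ∂(volume : Measure (EuclideanSpace ℝ (Fin N))),
      (P.map (x 0)).rnDeriv volume y ≤ K)
    -- the Jacobian determinants are bounded away from zero
    (hf_det : ∃ c : ℝ, 0 < c ∧ ∀ (y : EuclideanSpace ℝ (Fin N)) (a : W),
      c < |(fderiv ℝ (fun z => f (z, a)) y).det|)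
    -- the closed loop over the noiseless channel, and its stability
    (hloop : NoiselessControl.IsClosedLoop f w γ x q u)
    (hQt : NoiselessControl.IsAMSErgodic P x Qt) :
    Integrable (fun p : EuclideanSpace ℝ (Fin N) × W => NoiselessControl.logAbsDet f p.1 p.2)
        ((Qt.map (fun s => s 0)).prod ν) ∧
      ∫ a, ∫ y, NoiselessControl.logAbsDet f y a ∂(Qt.map (fun s => s 0)) ∂ν
        ≤ NoiselessControl.noiselessCapacity M := by
  obtain ⟨c, hc, hcdet⟩ := hf_det
  obtain ⟨K, hK⟩ := hx0_bdd
  have hd : ∀ a, Differentiable ℝ fun y => f (y, a) := fun a =>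
    (hf_C1 a).differentiable one_ne_zero
  have hdet : ∀ y a, (fderiv ℝ (fun z => f (z, a)) y).det ≠ 0 := fun y a =>
    abs_pos.1 (hc.trans (hcdet y a))
  have hν : IsProbabilityMeasure ν := by
    rw [← hw_law 0]
    exact Measure.isProbabilityMeasure_map (hw_meas 0).aemeasurable
  have := hQt.isAMS.isProbabilityMeasure
  have hQ : IsProbabilityMeasure (Qt.map fun s : ℕ → EuclideanSpace ℝ (Fin N) => s 0) :=
    Measure.isProbabilityMeasure_map (measurable_pi_apply 0).aemeasurable
  have := Measure.isProbabilityMeasure_map (μ := P) hx0_meas.aemeasurable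
  have hg := NoiselessControl.measurable_logAbsDet hf_meas hd
  have hlow : ∀ p : EuclideanSpace ℝ (Fin N) × W,
      Real.logb 2 c ≤ NoiselessControl.logAbsDet f p.1 p.2 := fun p =>
    Real.logb_le_logb_of_le one_lt_two hc (hcdet p.1 p.2).le
  have hmain := NoiselessControl.integrable_and_integral_le_of_truncations
    (μ := (Qt.map fun s => s 0).prod ν) (C := NoiselessControl.noiselessCapacity M) hg hlow
    fun n => by
      have hb : ∀ p : EuclideanSpace ℝ (Fin N) × W,
          |min (NoiselessControl.logAbsDet f p.1 p.2) n| ≤ max |min (Real.logb 2 c) n| |(n : ℝ)| :=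
        fun p => abs_le_max_abs_abs (min_le_min_right _ (hlow p)) (min_le_right _ _)
      have hm := hg.min (measurable_const (a := (n : ℝ)))
      rw [integral_prod _ (Integrable.of_bound hm.aestronglyMeasurable _
        (Eventually.of_forall hb))]
      exact hloop.integral_le_capacity_of_bounded hQt hf_meas hw_meas hw_indep hw_law hx0_meas
        hx0_indep hd hf_inj hdet (NoiselessControl.measure_le_mul_of_rnDeriv_le hx0_ac hK) hm hb
        fun y a => min_le_left _ _
  refine ⟨hmain.1, ?_⟩
  rw [integral_prod_symm _ hmain.1] at hmain
  exact hmain.2
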